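/- Let $\lambda=(\lambda_n)$ be a frequency, i.e. a strictly increasing sequence of non-negative real numbers tending to $+\infty$. Let $\mathcal D_\infty^{ext}(\lambda)$ be the set of all formal Dirichlet series $D=\sum a_n e^{-\lambda_n s}$ with complex coefficients $a_n$ (two series being equal when all their coefficients agree) which converge at some $s\in\mathbb C$ and whose limit function has a holomorphic and bounded extension $f$ to $[\mathrm{Re}>0]=\{s\in\mathbb C:\mathrm{Re}\,s>0\}$; that is, $f$ is holomorphic and bounded on $[\mathrm{Re}>0]$ and coincides with the sum of $D$ on every half-plane $[\mathrm{Re}>\sigma_0]$, $\sigma_0\ge 0$, on which $D$ converges. Put $\|D\|_\infty:=\sup_{\mathrm{Re}\,s>0}|f(s)|$. A continuous function $g\colon\mathbb R\to\mathbb C$ is called (uniformly) almost periodic if for every $\varepsilon>0$ there is $l>0$ such that every interval of length $l$ contains some $\tau$ with $\sup_{t\in\mathbb R}|g(t+\tau)-g(t)|\le\varepsilon$. Let $D=\sum a_n e^{-\lambda_n s}\in\mathcal D_\infty^{ext}(\lambda)$ with extension $f$. Then for every $\sigma>0$ the function $t\mapsto f(\sigma+it)$ is almost periodic on $\mathbb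 R$, and for every $n$ $$a_n=\lim_{T\to\infty}\frac1{2T}\int_{-T}^{T} f(\sigma+it)\,e^{(\sigma+it)\lambda_n}\,dt .$$ In particular, $\sup_n|a_n|\le\|D\|_\infty$. Moreover, $\|D\|_\infty$ does not depend on the choice of the extension, $\mathcal D_\infty^{ext}(\lambda)$ is a complex vector space under coefficientwise operations, and $\|\cdot\|_\infty$ is a norm on it. -/

import Mathlib

open Filter Topology

noncomputable section

namespace GenDirichlet

/-- A frequency: a strictly increasing non-negative real sequence tending to `+∞`
(indexed from `0`). -/
structure IsFrequency (lam : ℕ → ℝ) : Prop where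
  strictMono : StrictMono lam
  nonneg : ∀ n, 0 ≤ lam n
  tendsto : Tendsto lam atTop atTop

/-- The `N`-th partial sum `∑_{n < N} a n * exp (-lam n * s)` of the formal `lam`-Dirichlet series
with coefficients `a`. Formal `lam`-Dirichlet series are identified with their coefficient
sequences `a : ℕ → ℂ`. -/
def partialSum (lam : ℕ → ℝ) (a : ℕ → ℂ) (N : ℕ) (s : ℂ) : ℂ :=
  ∑ n ∈ Finset.range N, a n * Complex.exp (-(lam n : ℂ) * s)

/-- The series converges (not necessarily absolutely) at `s`. -/
def ConvergesAt (lam : ℕ → ℝ) (a : ℕ → ℂ) (s : ℂ) : Prop :=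
  ∃ l : ℂ, Tendsto (fun N => partialSum lam a N s) atTop (𝓝 l)

/-- `f` is a holomorphic and bounded extension to `[Re > 0]` of the limit function of the series:
`f` is holomorphic and bounded on `[Re > 0]` and coincides with the sum of the series on every
half-plane `[Re > σ₀]`, `σ₀ ≥ 0`, on which the series converges, i.e. on
`[Re > max 0 σ_c]`. Values of `f` outside `[Re > 0]` are irrelevant. -/
structure IsBddExtension (lam : ℕ → ℝ) (a : ℕ → ℂ) (f : ℂ → ℂ) : Prop where
  holomorphic : DifferentiableOn ℂ f {s : ℂ | 0 < s.re}
  bounded : ∃ C : ℝ, ∀ s : ℂ, 0 < s.re → ‖f s‖ ≤ C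
  eq_sum : ∀ σ₀ : ℝ, 0 ≤ σ₀ → (∀ s : ℂ, σ₀ < s.re → ConvergesAt lam a s) →
    ∀ s : ℂ, σ₀ < s.re → Tendsto (fun N => partialSum lam a N s) atTop (𝓝 (f s))

/-- The space `D_∞^ext(lam)` of all somewhere convergent `lam`-Dirichlet series which allow a
holomorphic and bounded extension to `[Re > 0]`. -/
def DInftyExt (lam : ℕ → ℝ) : Set (ℕ → ℂ) :=
  {a | (∃ s : ℂ, ConvergesAt lam a s) ∧ ∃ f : ℂ → ℂ, IsBddExtension lam a f}

open Classical in
/-- `‖D‖_∞ = sup_{Re s > 0} |f s|`, where `f` is the extension of `D` (and `0` if there is none). -/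
def normInfty (lam : ℕ → ℝ) (a : ℕ → ℂ) : ℝ :=
  if h : ∃ f : ℂ → ℂ, IsBddExtension lam a f then
    ⨆ s : {s : ℂ // 0 < s.re}, ‖h.choose s‖
  else 0

/-- Bohr's (uniformly) almost periodic functions on `ℝ`. -/
def AlmostPeriodic (g : ℝ → ℂ) : Prop :=
  Continuous g ∧ ∀ ε : ℝ, 0 < ε → ∃ l : ℝ, 0 < l ∧
    ∀ x : ℝ, ∃ τ ∈ Set.Icc x (x + l), ∀ t : ℝ, ‖g (t + τ) - g t‖ ≤ ε

end GenDirichlet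

end

namespace GenDirichlet

open MeasureTheory

/-! On each vertical line in `[Re > 0]` the extension `f` is a uniform limit of Dirichlet
polynomials, although the series itself may diverge there. To see this, average `f` vertically
against a kernel: `∫ f (s + iδu) φ u du`. Far to the right the series may be integrated termwise,
which multiplies `a n` by the Fourier transform of `φ` at `δ * lam n`. If that transform has compact
support, only finitely many terms survive, and the identity theorem carries the resulting formula to
all of `[Re > 0]` (`vertical_average_eq_partialSum`). Cauchy's estimate makes `f` Lipschitz along
vertical lines, so the averages are within `O(δ)` of `f` uniformly in the height. If the transform
is `1` near `0`, a small `δ` also leaves a chosen `a m` intact (`exists_partialSum_near`).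

Almost periodicity and the mean value formula hold for Dirichlet polynomials and survive uniform
limits. Letting `σ → 0` in the formula bounds the coefficients, which makes the norm definite. -/

/-! ### Abel summation and half-planes of convergence -/

/-- The derivative of `exp (-t * w)` in `t` has norm `‖w‖ * exp (-t * w.re)`, which integrates to
the right-hand side. A bound of this shape telescopes along `lam n`. -/
lemma norm_exp_sub_exp_le {x y : ℝ} (hxy : x ≤ y) {w : ℂ} (hw : 0 < w.re) :
    ‖Complex.exp (-(x : ℂ) * w) - Complex.exp (-(y : ℂ) * w)‖ ≤
      ‖w‖ / w.re * (Real.exp (-x * w.re) - Real.exp (-y * w.re)) := by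
  have hd : ∀ t : ℝ, HasDerivAt
      (fun t : ℝ => Complex.exp (-(x : ℂ) * w) - Complex.exp (-(t : ℂ) * w))
      (-(Complex.exp (-(t : ℂ) * w) * (-1 * w))) t := fun t =>
    (((Complex.ofRealCLM.hasDerivAt (x := t)).neg.mul_const w).cexp).const_sub _
  have hB : ∀ t : ℝ, HasDerivAt
      (fun t : ℝ => ‖w‖ / w.re * (Real.exp (-x * w.re) - Real.exp (-t * w.re)))
      (‖w‖ / w.re * -(Real.exp (-t * w.re) * (-1 * w.re))) t := fun t =>
    ((((hasDerivAt_id t).neg.mul_const w.re).exp).const_sub _).const_mul _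
  refine image_norm_le_of_norm_deriv_right_le_deriv_boundary
    (f := fun t : ℝ => Complex.exp (-(x : ℂ) * w) - Complex.exp (-(t : ℂ) * w))
    (a := x) (b := y)
    (fun t _ => (hd t).continuousAt.continuousWithinAt) (fun t _ => (hd t).hasDerivWithinAt)
    (by simp) hB (fun t _ => ?_) ⟨hxy, le_rfl⟩
  have : ‖Complex.exp (-(t : ℂ) * w)‖ = Real.exp (-t * w.re) := by
    rw [Complex.norm_exp]; simp
  rw [norm_neg, norm_mul, this]
  apply le_of_eq
  field_simp
  simp

variable {lam : ℕ → ℝ} {a : ℕ → ℂ}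

/-- Abel's summation bound for the sum of the increments of `X` against `exp (-lam n * w)`. -/
lemma norm_sum_increments_mul_exp_le (hlam : IsFrequency lam) {X : ℕ → ℂ} {ε : ℝ} {M : ℕ}
    (hX : ∀ n, M ≤ n → ‖X n‖ ≤ ε) {w : ℂ} (hw : 0 < w.re) {N : ℕ} (hN : M ≤ N) :
    ‖∑ n ∈ Finset.Ico M N, (X (n + 1) - X n) * Complex.exp (-(lam n : ℂ) * w)‖ ≤
      ε * (2 + ‖w‖ / w.re) := by
  have hε : 0 ≤ ε := (norm_nonneg _).trans (hX M le_rfl)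
  have hK : 0 ≤ ‖w‖ / w.re := by positivity
  -- With the boundary terms moved to the left, passing from `N` to `N + 1` adds exactly `X (N + 1)`
  -- times a difference of consecutive exponentials. The two boundary terms account for the `2` in
  -- the final bound.
  have key : ‖∑ n ∈ Finset.Ico M N, (X (n + 1) - X n) * Complex.exp (-(lam n : ℂ) * w)
      - X N * Complex.exp (-(lam N : ℂ) * w) + X M * Complex.exp (-(lam M : ℂ) * w)‖ ≤
      ε * (‖w‖ / w.re * (Real.exp (-lam M * w.re) - Real.exp (-lam N * w.re))) := by
    induction N, hN using Nat.le_induction with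
    | base => simp
    | succ N hN ih =>
      rw [Finset.sum_Ico_succ_top hN]
      have h1 : ‖X (N + 1) * (Complex.exp (-(lam N : ℂ) * w)
          - Complex.exp (-(lam (N + 1) : ℂ) * w))‖ ≤
          ε * (‖w‖ / w.re * (Real.exp (-lam N * w.re) - Real.exp (-lam (N + 1) * w.re))) := by
        rw [norm_mul]
        exact mul_le_mul (hX _ (by omega))
          (norm_exp_sub_exp_le (hlam.strictMono.monotone (Nat.le_succ N)) hw)
          (norm_nonneg _) hε
      refine le_trans (le_of_eq (congrArg norm ?_)) ((norm_add_le _ _).trans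
        ((add_le_add ih h1).trans (le_of_eq (by ring))))
      ring
  have hE : ∀ n, ‖Complex.exp (-(lam n : ℂ) * w)‖ ≤ 1 := fun n => by
    rw [Complex.norm_exp, Real.exp_le_one_iff]
    simpa using mul_nonneg (hlam.nonneg n) hw.le
  have hb : ∀ n, M ≤ n → ‖X n * Complex.exp (-(lam n : ℂ) * w)‖ ≤ ε := fun n hn => by
    rw [norm_mul]
    exact (mul_le_mul (hX n hn) (hE n) (norm_nonneg _) hε).trans (by simp)
  have hM1 : Real.exp (-lam M * w.re) - Real.exp (-lam N * w.re) ≤ 1 := by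
    have h1 : Real.exp (-lam M * w.re) ≤ 1 := by
      rw [Real.exp_le_one_iff]
      nlinarith [mul_nonneg (hlam.nonneg M) hw.le]
    linarith [Real.exp_pos (-lam N * w.re)]
  have h2 : ε * (‖w‖ / w.re * (Real.exp (-lam M * w.re) - Real.exp (-lam N * w.re))) ≤
      ε * (‖w‖ / w.re) :=
    mul_le_mul_of_nonneg_left (mul_le_of_le_one_right hK hM1) hε
  calc _ = ‖(∑ n ∈ Finset.Ico M N, (X (n + 1) - X n) * Complex.exp (-(lam n : ℂ) * w)
        - X N * Complex.exp (-(lam N : ℂ) * w) + X M * Complex.exp (-(lam M : ℂ) * w))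
        + X N * Complex.exp (-(lam N : ℂ) * w) - X M * Complex.exp (-(lam M : ℂ) * w)‖ :=
        congrArg norm (by ring)
    _ ≤ _ := norm_sub_le _ _
    _ ≤ _ := add_le_add (norm_add_le _ _) le_rfl
    _ ≤ ε * (‖w‖ / w.re) + ε + ε :=
        add_le_add (add_le_add (key.trans h2) (hb N hN)) (hb M le_rfl)
    _ = _ := by ring

/-- Abel's bound with `s₀` moved to the origin. Taking `l = 0` gives growth estimates; taking `l` to
be the sum at `s₀` gives the Cauchy property. -/
lemma norm_partialSum_sub_le (hlam : IsFrequency lam) {s₀ l : ℂ} {ε : ℝ} {M : ℕ}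
    (hX : ∀ n, M ≤ n → ‖partialSum lam a n s₀ - l‖ ≤ ε) {s : ℂ} (hs : s₀.re < s.re) {N : ℕ}
    (hN : M ≤ N) :
    ‖partialSum lam a N s - partialSum lam a M s‖ ≤
      ε * (2 + ‖s - s₀‖ / (s.re - s₀.re)) := by
  have h := norm_sum_increments_mul_exp_le hlam (X := fun n => partialSum lam a n s₀ - l) hX
    (w := s - s₀) (by simpa using hs) hN
  rw [Complex.sub_re] at h
  convert h using 2
  unfold partialSum
  rw [← Finset.sum_Ico_eq_sub _ hN]
  refine Finset.sum_congr rfl fun n _ => ?_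
  rw [Finset.sum_range_succ]
  have : Complex.exp (-(lam n : ℂ) * s) =
    Complex.exp (-(lam n : ℂ) * s₀) * Complex.exp (-(lam n : ℂ) * (s - s₀)) := by
    rw [← Complex.exp_add]; ring_nf
  rw [this]
  ring

/-- Partial sums grow at most linearly along vertical lines right of a point of convergence. -/
lemma exists_norm_partialSum_le (hlam : IsFrequency lam) {s₀ : ℂ} (h₀ : ConvergesAt lam a s₀) :
    ∃ B : ℝ, 0 ≤ B ∧ ∀ s : ℂ, s₀.re < s.re → ∀ N,
      ‖partialSum lam a N s‖ ≤ B * (2 + ‖s - s₀‖ / (s.re - s₀.re)) := by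
  obtain ⟨l, hl⟩ := h₀
  obtain ⟨B, hB⟩ := (Metric.isBounded_range_of_tendsto _ hl).exists_norm_le
  have hB' : ∀ n, ‖partialSum lam a n s₀‖ ≤ B := fun n => hB _ ⟨n, rfl⟩
  refine ⟨B, (norm_nonneg _).trans (hB' 0), fun s hs N => ?_⟩
  simpa [partialSum] using norm_partialSum_sub_le hlam (a := a) (s₀ := s₀) (l := 0) (ε := B)
    (M := 0) (fun n _ => by simpa using hB' n) hs (Nat.zero_le N)

/-- On a set where `‖s - s₀‖ / Re (s - s₀)` is bounded the series is uniformly Cauchy. -/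
lemma uniformCauchySeqOn_partialSum (hlam : IsFrequency lam) {s₀ : ℂ}
    (h₀ : ConvergesAt lam a s₀) {K : ℝ} {S : Set ℂ}
    (hS : ∀ s ∈ S, s₀.re < s.re ∧ ‖s - s₀‖ / (s.re - s₀.re) ≤ K) :
    UniformCauchySeqOn (partialSum lam a) atTop S := by
  obtain ⟨l, hl⟩ := h₀
  rw [Metric.uniformCauchySeqOn_iff]
  intro ε hε
  have hη : 0 < ε / (4 * (2 + |K|)) := by positivity
  obtain ⟨M, hM⟩ := Metric.tendsto_atTop.1 hl _ hη
  have hb : ∀ N, M ≤ N → ∀ s ∈ S,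
      ‖partialSum lam a N s - partialSum lam a M s‖ ≤ ε / 4 := fun N hN s hs => by
    refine (norm_partialSum_sub_le hlam (l := l)
      (fun n hn => (dist_eq_norm _ l ▸ hM n hn).le) (hS s hs).1 hN).trans ?_
    calc _ ≤ ε / (4 * (2 + |K|)) * (2 + |K|) := by
          gcongr
          exact (hS s hs).2.trans (le_abs_self K)
      _ = ε / 4 := by field_simp
  refine ⟨M, fun m hm n hn s hs => ?_⟩
  rw [dist_eq_norm]
  calc _ = ‖(partialSum lam a m s - partialSum lam a M s)
        - (partialSum lam a n s - partialSum lam a M s)‖ := congrArg norm (by ring)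
    _ ≤ _ := norm_sub_le _ _
    _ ≤ ε / 4 + ε / 4 := add_le_add (hb m hm s hs) (hb n hn s hs)
    _ < ε := by linarith

lemma ConvergesAt.of_re_lt (hlam : IsFrequency lam) {s₀ s : ℂ} (h₀ : ConvergesAt lam a s₀)
    (hs : s₀.re < s.re) : ConvergesAt lam a s :=
  cauchySeq_tendsto_of_complete
    ((uniformCauchySeqOn_partialSum hlam h₀ (S := {s})
      (K := ‖s - s₀‖ / (s.re - s₀.re)) (by rintro _ rfl; exact ⟨hs, le_rfl⟩)).cauchySeq rfl)

lemma differentiable_partialSum (N : ℕ) : Differentiable ℂ (partialSum lam a N) := by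
  unfold partialSum
  fun_prop

/-- The sum of a Dirichlet series is holomorphic on an open half-plane of convergence. -/
lemma differentiableOn_of_tendsto (hlam : IsFrequency lam) {σ₀ : ℝ} {g : ℂ → ℂ}
    (hg : ∀ s : ℂ, σ₀ < s.re → Tendsto (fun N => partialSum lam a N s) atTop (𝓝 (g s))) :
    DifferentiableOn ℂ g {s : ℂ | σ₀ < s.re} := by
  have hopen : IsOpen {s : ℂ | σ₀ < s.re} := isOpen_lt continuous_const Complex.continuous_re
  refine TendstoLocallyUniformlyOn.differentiableOn (φ := atTop) (F := partialSum lam a) ?_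
    (Eventually.of_forall fun N => (differentiable_partialSum N).differentiableOn) hopen
  rw [tendstoLocallyUniformlyOn_iff_forall_isCompact hopen]
  intro K hK hKc
  rcases K.eq_empty_or_nonempty with rfl | hne
  · exact tendstoUniformlyOn_empty
  obtain ⟨z, hz, hzmin⟩ := hKc.exists_isMinOn hne Complex.continuous_re.continuousOn
  have hz' : σ₀ < z.re := hK hz
  -- A point strictly between the boundary line and `K`, so that the ratio controlling uniform
  -- convergence is continuous on `K`, hence bounded.
  set s₀ : ℂ := (((σ₀ + z.re) / 2 : ℝ) : ℂ) with hs₀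
  have hre : s₀.re = (σ₀ + z.re) / 2 := by rw [hs₀, Complex.ofReal_re]
  have hlt : ∀ s ∈ K, s₀.re < s.re := fun s hs => by
    have : z.re ≤ s.re := hzmin hs
    rw [hre]; linarith
  have hcont : ContinuousOn (fun s : ℂ => ‖s - s₀‖ / (s.re - s₀.re)) K := by
    refine ContinuousOn.div (by fun_prop) (by fun_prop) fun s hs => ?_
    exact (sub_pos.2 (hlt s hs)).ne'
  obtain ⟨C, hC⟩ := (hKc.bddAbove_image hcont)
  refine (uniformCauchySeqOn_partialSum hlam (s₀ := s₀) (K := C)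
    ⟨_, hg s₀ (by rw [hre]; linarith)⟩
    fun s hs => ⟨hlt s hs, hC ⟨s, hs, rfl⟩⟩).tendstoUniformlyOn_of_tendsto
    fun s hs => hg s (hK hs)

/-! ### Uniqueness of the extension -/

/-- Two functions holomorphic on a half-plane that agree on a smaller half-plane are equal. -/
lemma eq_of_eq_on_halfPlane {σ₀ σ₁ : ℝ} {g h : ℂ → ℂ}
    (hg : DifferentiableOn ℂ g {s : ℂ | σ₀ < s.re}) (hh : DifferentiableOn ℂ h {s : ℂ | σ₀ < s.re})
    (heq : ∀ s : ℂ, σ₁ < s.re → g s = h s) {s : ℂ} (hs : σ₀ < s.re) : g s = h s := by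
  have hopen : ∀ σ : ℝ, IsOpen {s : ℂ | σ < s.re} := fun σ =>
    isOpen_lt continuous_const Complex.continuous_re
  set z : ℂ := ((max σ₀ σ₁ + 1 : ℝ) : ℂ) with hz
  have hzre : z.re = max σ₀ σ₁ + 1 := by rw [hz, Complex.ofReal_re]
  have hz0 : σ₀ < z.re := by rw [hzre]; linarith [le_max_left σ₀ σ₁]
  have hz1 : σ₁ < z.re := by rw [hzre]; linarith [le_max_right σ₀ σ₁]
  refine (hg.analyticOnNhd (hopen σ₀)).eqOn_of_preconnected_of_eventuallyEq
    (hh.analyticOnNhd (hopen σ₀)) ((convex_halfSpace_re_gt σ₀).isPreconnected) hz0 ?_ hs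
  filter_upwards [(hopen σ₁).mem_nhds hz1] with s hs using heq s hs

lemma ConvergesAt.tendsto_extension (hlam : IsFrequency lam) {s₀ : ℂ}
    (h₀ : ConvergesAt lam a s₀) {f : ℂ → ℂ} (hf : IsBddExtension lam a f) {s : ℂ}
    (hs : max 0 s₀.re < s.re) : Tendsto (fun N => partialSum lam a N s) atTop (𝓝 (f s)) :=
  hf.eq_sum (max 0 s₀.re) (le_max_left _ _)
    (fun _ hz => h₀.of_re_lt hlam ((le_max_right _ _).trans_lt hz)) s hs

/-- A bounded holomorphic function which is the sum of the series on some half-plane is a bounded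
extension of the series. -/
lemma IsBddExtension.of_eventually (hlam : IsFrequency lam) {f : ℂ → ℂ}
    (hf : DifferentiableOn ℂ f {s : ℂ | 0 < s.re}) (hb : ∃ C : ℝ, ∀ s : ℂ, 0 < s.re → ‖f s‖ ≤ C)
    {σ₁ : ℝ}
    (hsum : ∀ s : ℂ, σ₁ < s.re → Tendsto (fun N => partialSum lam a N s) atTop (𝓝 (f s))) :
    IsBddExtension lam a f where
  holomorphic := hf
  bounded := hb
  eq_sum σ₀ hσ₀ hconv s hs := by
    choose! g hg using hconv
    have hmono : {s : ℂ | σ₀ < s.re} ⊆ {s : ℂ | 0 < s.re} := fun z hz => hσ₀.trans_lt hz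
    have : g s = f s := eq_of_eq_on_halfPlane (σ₁ := max σ₀ σ₁)
      (differentiableOn_of_tendsto hlam hg) (hf.mono hmono)
      (fun z hz => tendsto_nhds_unique (hg z ((le_max_left _ _).trans_lt hz))
        (hsum z ((le_max_right _ _).trans_lt hz))) hs
    exact this ▸ hg s hs

lemma IsBddExtension.eq_of_convergesAt (hlam : IsFrequency lam) {s₀ : ℂ}
    (h₀ : ConvergesAt lam a s₀) {f g : ℂ → ℂ} (hf : IsBddExtension lam a f)
    (hg : IsBddExtension lam a g) {s : ℂ} (hs : 0 < s.re) : f s = g s :=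
  eq_of_eq_on_halfPlane (σ₁ := max 0 s₀.re) hf.holomorphic hg.holomorphic
    (fun _ hz => tendsto_nhds_unique (h₀.tendsto_extension hlam hf hz)
      (h₀.tendsto_extension hlam hg hz)) hs

/-! ### Smoothing along vertical lines -/

/-- A rapidly decreasing kernel whose Fourier transform is a plateau function. -/
lemma exists_plateau_kernel : ∃ φ : ℝ → ℂ, Continuous φ ∧ Integrable φ ∧
    Integrable (fun u : ℝ => |u| * ‖φ u‖) ∧
    (∀ x : ℝ, |x| ≤ 1 → ∫ u : ℝ, Complex.exp (-(x : ℂ) * (u * Complex.I)) * φ u = 1) ∧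
    (∀ x : ℝ, 16 ≤ |x| → ∫ u : ℝ, Complex.exp (-(x : ℂ) * (u * Complex.I)) * φ u = 0) := by
  -- The bump is `1` on `[-1, 1]` and `0` beyond `2`. The transform is evaluated at `x / (2π)`, so
  -- `|x| ≤ 1` lies on the plateau and `|x| ≥ 16 > 4π` outside the support.
  let b : ContDiffBump (0 : ℝ) := ⟨1, 2, one_pos, one_lt_two⟩
  have hb : ContDiff ℝ ((⊤ : ℕ∞) : WithTop ℕ∞) (fun x => ((b x : ℝ) : ℂ)) :=
    Complex.ofRealCLM.contDiff.comp b.contDiff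
  have hc : HasCompactSupport (fun x => ((b x : ℝ) : ℂ)) :=
    b.hasCompactSupport.comp_left (g := fun y : ℝ => (y : ℂ)) Complex.ofReal_zero
  let ψ : SchwartzMap ℝ ℂ := hc.toSchwartzMap hb
  let φ : SchwartzMap ℝ ℂ := FourierTransformInv.fourierInv ψ
  have hF : ∀ x : ℝ, ∫ u : ℝ, Complex.exp (-(x : ℂ) * (u * Complex.I)) * φ u =
      ((b (x / (2 * Real.pi)) : ℝ) : ℂ) := fun x => by
    have h1 : FourierTransform.fourier φ = ψ := FourierTransform.fourier_fourierInv_eq ψ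
    have h2 : FourierTransform.fourier (φ : ℝ → ℂ) (x / (2 * Real.pi)) =
        ((b (x / (2 * Real.pi)) : ℝ) : ℂ) := by
      rw [← SchwartzMap.fourier_coe, h1]; rfl
    rw [← h2, Real.fourier_real_eq_integral_exp_smul]
    refine integral_congr_ae (Eventually.of_forall fun u => ?_)
    simp only [smul_eq_mul]
    congr 2
    have := Real.pi_ne_zero
    push_cast
    field_simp
  have hpi := Real.pi_gt_three
  have hpi' := Real.pi_lt_four
  have habs : ∀ x : ℝ, |x / (2 * Real.pi)| = |x| / (2 * Real.pi) := fun x => by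
    rw [abs_div, abs_of_pos (by positivity : 0 < 2 * Real.pi)]
  refine ⟨φ, φ.continuous, φ.integrable, by simpa using φ.integrable_pow_mul volume 1,
    fun x hx => ?_, fun x hx => ?_⟩
  · rw [hF, b.one_of_mem_closedBall, Complex.ofReal_one]
    rw [mem_closedBall_zero_iff, Real.norm_eq_abs, habs, div_le_iff₀ (by positivity)]
    change |x| ≤ 1 * _
    linarith
  · rw [hF, b.zero_of_le_dist, Complex.ofReal_zero]
    rw [dist_zero_right, Real.norm_eq_abs, habs, le_div_iff₀ (by positivity)]
    change 2 * _ ≤ |x|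
    linarith

lemma norm_deriv_le_of_bounded {f : ℂ → ℂ} (hf : DifferentiableOn ℂ f {s : ℂ | 0 < s.re}) {C : ℝ}
    (hC : ∀ s : ℂ, 0 < s.re → ‖f s‖ ≤ C) {r : ℝ} (hr : 0 < r) {s : ℂ} (hs : r < s.re) :
    ‖deriv f s‖ ≤ C / r := by
  have hsub : Metric.closedBall s r ⊆ {s : ℂ | 0 < s.re} := fun z hz => by
    have h1 : |(z - s).re| ≤ r := (Complex.abs_re_le_norm _).trans (mem_closedBall_iff_norm.1 hz)
    rw [Complex.sub_re, abs_le] at h1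
    change 0 < z.re
    linarith
  exact Complex.norm_deriv_le_of_forall_mem_sphere_norm_le hr
    (hf.mono (by rwa [closure_ball s hr.ne'])).diffContOnCl
    fun z hz => hC z (hsub (Metric.sphere_subset_closedBall hz))

lemma re_add_ofReal_mul_I (s : ℂ) (x : ℝ) : (s + x * Complex.I).re = s.re := by simp

lemma continuous_comp_vertical {f : ℂ → ℂ} (hf : DifferentiableOn ℂ f {s : ℂ | 0 < s.re}) {s : ℂ}
    (hs : 0 < s.re) (δ : ℝ) : Continuous fun u : ℝ => f (s + (δ * u : ℝ) * Complex.I) :=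
  hf.continuousOn.comp_continuous (by fun_prop) fun u => by
    rwa [Set.mem_ofPred_eq, re_add_ofReal_mul_I]

/-- Vertical averages of a bounded holomorphic function on `[Re > 0]` are holomorphic. -/
lemma differentiableOn_vertical_average {f : ℂ → ℂ}
    (hf : DifferentiableOn ℂ f {s : ℂ | 0 < s.re}) (hb : ∃ C : ℝ, ∀ s : ℂ, 0 < s.re → ‖f s‖ ≤ C)
    {φ : ℝ → ℂ} (hφc : Continuous φ) (hφ : Integrable φ) (δ : ℝ) :
    DifferentiableOn ℂ (fun s => ∫ u : ℝ, f (s + (δ * u : ℝ) * Complex.I) * φ u)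
      {s : ℂ | 0 < s.re} := by
  obtain ⟨C, hC⟩ := hb
  have hopen : ∀ σ : ℝ, IsOpen {s : ℂ | σ < s.re} := fun σ =>
    isOpen_lt continuous_const Complex.continuous_re
  intro s hs
  have hs' : 0 < s.re := hs
  have hmeas : ∀ z : ℂ, 0 < z.re →
      AEStronglyMeasurable (fun u : ℝ => f (z + (δ * u : ℝ) * Complex.I) * φ u) := fun z hz =>
    ((continuous_comp_vertical hf hz δ).mul hφc).aestronglyMeasurable
  -- On `[Re > s.re / 2]` Cauchy's estimate with radius `s.re / 2` bounds `deriv f` uniformly, which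
  -- gives an integrable majorant.
  have hhalf : s.re / 2 < s.re := by linarith
  refine (hasDerivAt_integral_of_dominated_loc_of_deriv_le (𝕜 := ℂ) (μ := volume)
    (F' := fun z u => deriv f (z + (δ * u : ℝ) * Complex.I) * φ u)
    (bound := fun u => C / (s.re / 2) * ‖φ u‖)
    ((hopen (s.re / 2)).mem_nhds hhalf) ?_ ?_ ?_ ?_ (hφ.norm.const_mul _) ?_
    ).2.differentiableAt.differentiableWithinAt
  · filter_upwards [(hopen 0).mem_nhds hs'] with z hz using hmeas z hz
  · refine (hφ.norm.const_mul C).mono' (hmeas s hs') (Eventually.of_forall fun u => ?_)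
    rw [norm_mul]
    exact mul_le_mul_of_nonneg_right (hC _ (by rwa [re_add_ofReal_mul_I])) (norm_nonneg _)
  · exact (((measurable_deriv f).comp
      (by fun_prop : Continuous fun u : ℝ => s + (δ * u : ℝ) * Complex.I).measurable).mul
      hφc.measurable).aestronglyMeasurable
  · refine Eventually.of_forall fun u z hz => ?_
    have hz' : s.re / 2 < z.re := hz
    rw [norm_mul]
    exact mul_le_mul_of_nonneg_right (norm_deriv_le_of_bounded hf hC (by linarith)
      (by rwa [re_add_ofReal_mul_I])) (norm_nonneg _)
  · refine Eventually.of_forall fun u z hz => ?_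
    have hz' : s.re / 2 < z.re := hz
    have hd : DifferentiableAt ℂ f (z + (δ * u : ℝ) * Complex.I) :=
      hf.differentiableAt ((hopen 0).mem_nhds (by
        rw [Set.mem_ofPred_eq, re_add_ofReal_mul_I]; linarith))
    exact (hd.hasDerivAt.comp_add_const z _).mul_const (φ u)

lemma norm_comp_vertical_sub_le {f : ℂ → ℂ} (hf : DifferentiableOn ℂ f {s : ℂ | 0 < s.re}) {C : ℝ}
    (hC : ∀ s : ℂ, 0 < s.re → ‖f s‖ ≤ C) {r : ℝ} (hr : 0 < r) {s : ℂ} (hs : r < s.re) (x : ℝ) :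
    ‖f (s + x * Complex.I) - f s‖ ≤ C / r * |x| := by
  have hopen : IsOpen {s : ℂ | 0 < s.re} := isOpen_lt continuous_const Complex.continuous_re
  have h := Convex.norm_image_sub_le_of_norm_deriv_le (𝕜 := ℂ) (f := f) (C := C / r)
    (s := {s : ℂ | r < s.re}) (x := s) (y := s + x * Complex.I)
    (fun z hz => hf.differentiableAt (hopen.mem_nhds (hr.trans hz)))
    (fun z hz => norm_deriv_le_of_bounded hf hC hr hz) (convex_halfSpace_re_gt r) hs
    (by rwa [Set.mem_ofPred_eq, re_add_ofReal_mul_I])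
  simpa using h

/-- As `φ` has integral `1`, the error is the average of `f (s + iδu) - f s`, and the vertical
Lipschitz bound leaves the first absolute moment of `φ`. The bound does not depend on `s.im`. -/
lemma norm_vertical_average_sub_le {f : ℂ → ℂ} (hf : DifferentiableOn ℂ f {s : ℂ | 0 < s.re})
    {C : ℝ} (hC : ∀ s : ℂ, 0 < s.re → ‖f s‖ ≤ C) {φ : ℝ → ℂ} (hφc : Continuous φ)
    (hφ : Integrable φ) (hφ₁ : Integrable (fun u : ℝ => |u| * ‖φ u‖)) (hone : ∫ u, φ u = 1)
    {r : ℝ} (hr : 0 < r) {s : ℂ} (hs : r < s.re) {δ : ℝ} (hδ : 0 ≤ δ) :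
    ‖(∫ u : ℝ, f (s + (δ * u : ℝ) * Complex.I) * φ u) - f s‖ ≤
      δ * (C / r * ∫ u : ℝ, |u| * ‖φ u‖) := by
  have hs0 : 0 < s.re := hr.trans hs
  have hint : Integrable (fun u : ℝ => f (s + (δ * u : ℝ) * Complex.I) * φ u) := by
    refine (hφ.norm.const_mul C).mono'
      ((continuous_comp_vertical hf hs0 δ).mul hφc).aestronglyMeasurable
      (Eventually.of_forall fun u => ?_)
    rw [norm_mul]
    exact mul_le_mul_of_nonneg_right (hC _ (by rwa [re_add_ofReal_mul_I])) (norm_nonneg _)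
  have h1 : (∫ u : ℝ, f (s + (δ * u : ℝ) * Complex.I) * φ u) - f s =
      ∫ u : ℝ, (f (s + (δ * u : ℝ) * Complex.I) * φ u - f s * φ u) := by
    rw [integral_sub hint (hφ.const_mul _), integral_const_mul, hone, mul_one]
  rw [h1, ← mul_assoc, ← integral_const_mul]
  refine norm_integral_le_of_norm_le (hφ₁.const_mul _) (Eventually.of_forall fun u => ?_)
  rw [← sub_mul, norm_mul]
  calc _ ≤ C / r * |δ * u| * ‖φ u‖ :=
        mul_le_mul_of_nonneg_right (norm_comp_vertical_sub_le hf hC hr hs _) (norm_nonneg _)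
    _ = _ := by rw [abs_mul, abs_of_nonneg hδ]; ring

/-- Vertical averages of the extension against a kernel with compactly supported Fourier transform
are Dirichlet polynomials. -/
lemma vertical_average_eq_partialSum (hlam : IsFrequency lam) {s₀ : ℂ}
    (h₀ : ConvergesAt lam a s₀) {f : ℂ → ℂ} (hf : IsBddExtension lam a f)
    {φ : ℝ → ℂ} (hφc : Continuous φ)
    (hφ : Integrable φ) (hφ₁ : Integrable (fun u : ℝ => |u| * ‖φ u‖)) {δ : ℝ} {N : ℕ}
    (hN : ∀ n, N ≤ n →
      ∫ u : ℝ, Complex.exp (-((δ * lam n : ℝ) : ℂ) * (u * Complex.I)) * φ u = 0)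
    {s : ℂ} (hs : 0 < s.re) :
    ∫ u : ℝ, f (s + (δ * u : ℝ) * Complex.I) * φ u =
      partialSum lam (fun n => a n *
        ∫ u : ℝ, Complex.exp (-((δ * lam n : ℝ) : ℂ) * (u * Complex.I)) * φ u) N s := by
  refine eq_of_eq_on_halfPlane (σ₁ := max 0 s₀.re)
    (differentiableOn_vertical_average hf.holomorphic hf.bounded hφc hφ δ)
    (differentiable_partialSum N).differentiableOn (fun z hz => ?_) hs
  have hz0 : s₀.re < z.re := (le_max_right _ _).trans_lt hz
  obtain ⟨B, hB0, hB⟩ := exists_norm_partialSum_le hlam h₀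
  have hterm : ∀ n, Integrable (fun u : ℝ =>
      a n * Complex.exp (-(lam n : ℂ) * (z + (δ * u : ℝ) * Complex.I)) * φ u) := fun n => by
    refine (hφ.norm.const_mul (‖a n‖ * Real.exp (-lam n * z.re))).mono'
      (by fun_prop) (Eventually.of_forall fun u => ?_)
    rw [norm_mul, norm_mul, Complex.norm_exp]
    simp
  have hpart : ∀ M, ∫ u : ℝ, partialSum lam a M (z + (δ * u : ℝ) * Complex.I) * φ u =
      partialSum lam (fun n => a n *
        ∫ u : ℝ, Complex.exp (-((δ * lam n : ℝ) : ℂ) * (u * Complex.I)) * φ u) M z := fun M => by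
    unfold partialSum
    simp_rw [Finset.sum_mul]
    rw [integral_finsetSum _ fun n _ => hterm n]
    refine Finset.sum_congr rfl fun n _ => ?_
    rw [mul_right_comm, ← integral_const_mul]
    refine integral_congr_ae (Eventually.of_forall fun u => ?_)
    have : Complex.exp (-(lam n : ℂ) * (z + (δ * u : ℝ) * Complex.I)) =
        Complex.exp (-(lam n : ℂ) * z) *
          Complex.exp (-((δ * lam n : ℝ) : ℂ) * (u * Complex.I)) := by
      rw [← Complex.exp_add]
      congr 1
      push_cast
      ring
    simp only [this]
    ring
  have hlim : Tendsto
      (fun M => ∫ u : ℝ, partialSum lam a M (z + (δ * u : ℝ) * Complex.I) * φ u) atTop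
      (𝓝 (∫ u : ℝ, f (z + (δ * u : ℝ) * Complex.I) * φ u)) := by
    -- Partial sums grow at most linearly in the height, so the finite first moment of `φ` provides
    -- the majorant.
    have hbi : Integrable (fun u : ℝ => (B * (2 + ‖z - s₀‖ / (z.re - s₀.re))) * ‖φ u‖
        + (B * |δ| / (z.re - s₀.re)) * (|u| * ‖φ u‖)) :=
      (hφ.norm.const_mul _).add (hφ₁.const_mul _)
    refine tendsto_integral_of_dominated_convergence _ (fun M => ?_) hbi
      (fun M => Eventually.of_forall fun u => ?_) (Eventually.of_forall fun u => ?_)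
    · have := (differentiable_partialSum (lam := lam) (a := a) M).continuous
      exact ((this.comp (by fun_prop : Continuous fun u : ℝ =>
        z + (δ * u : ℝ) * Complex.I)).mul hφc).aestronglyMeasurable
    · have hd : 0 < z.re - s₀.re := sub_pos.2 hz0
      have h1 := hB (z + (δ * u : ℝ) * Complex.I) (by rwa [re_add_ofReal_mul_I]) M
      rw [re_add_ofReal_mul_I] at h1
      have h2 : ‖z + (δ * u : ℝ) * Complex.I - s₀‖ ≤ ‖z - s₀‖ + |δ| * |u| := by
        rw [add_sub_right_comm]
        refine (norm_add_le _ _).trans (le_of_eq ?_)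
        simp
      rw [norm_mul]
      calc _ ≤ B * (2 + (‖z - s₀‖ + |δ| * |u|) / (z.re - s₀.re)) * ‖φ u‖ := by
            refine mul_le_mul_of_nonneg_right (h1.trans ?_) (norm_nonneg _)
            gcongr
        _ = _ := by field_simp; ring
    · exact (h₀.tendsto_extension hlam hf (by rwa [re_add_ofReal_mul_I])).mul_const _
  -- The integrated partial sums are constant from `N` on, since all later multipliers vanish.
  refine tendsto_nhds_unique hlim (tendsto_const_nhds.congr' ?_)
  filter_upwards [eventually_ge_atTop N] with M hM
  rw [hpart]
  unfold partialSum
  refine Finset.sum_subset (Finset.range_mono hM) fun n _ hn => ?_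
  simp only [hN n (by simpa using hn), mul_zero, zero_mul]

/-- The extension is approximated uniformly on vertical lines by Dirichlet polynomials, with any
prescribed coefficient left unchanged. -/
lemma exists_partialSum_near (hlam : IsFrequency lam) (ha : a ∈ DInftyExt lam) {f : ℂ → ℂ}
    (hf : IsBddExtension lam a f) {σ : ℝ} (hσ : 0 < σ) {ε : ℝ} (hε : 0 < ε) (m : ℕ) :
    ∃ N > m, ∃ b : ℕ → ℂ, b m = a m ∧
      ∀ t : ℝ, ‖f (σ + t * Complex.I) - partialSum lam b N (σ + t * Complex.I)‖ ≤ ε := by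
  obtain ⟨φ, hφc, hφ, hφ₁, hone, hzero⟩ := exists_plateau_kernel
  obtain ⟨⟨s₀, h₀⟩, -⟩ := ha
  obtain ⟨C, hC⟩ := hf.bounded
  have hφone : ∫ u, φ u = 1 := by simpa using hone 0 (by simp)
  set K := C / (σ / 2) * ∫ u : ℝ, |u| * ‖φ u‖ with hK
  obtain ⟨δ, hδ, hδK, hδm⟩ : ∃ δ : ℝ, 0 < δ ∧ δ * K ≤ ε ∧ δ * lam m ≤ 1 := by
    have h1 : Tendsto (fun δ : ℝ => δ * K) (𝓝[>] 0) (𝓝 0) :=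
      ((continuous_mul_const K).tendsto' 0 0 (zero_mul K)).mono_left nhdsWithin_le_nhds
    have h2 : Tendsto (fun δ : ℝ => δ * lam m) (𝓝[>] 0) (𝓝 0) :=
      ((continuous_mul_const (lam m)).tendsto' 0 0 (zero_mul _)).mono_left nhdsWithin_le_nhds
    obtain ⟨δ, hδ⟩ := ((eventually_mem_nhdsWithin (a := (0 : ℝ)) (s := Set.Ioi 0)).and
      ((h1.eventually (eventually_le_nhds hε)).and
        (h2.eventually (eventually_le_nhds one_pos)))).exists
    exact ⟨δ, hδ.1, hδ.2⟩
  obtain ⟨N, hN⟩ := eventually_atTop.1 (hlam.tendsto.eventually_ge_atTop (16 / δ))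
  -- Beyond `N` one has `δ * lam n ≥ 16`, where the multiplier is `0`; `m + 1` keeps the `m`-th term
  -- inside the sum.
  refine ⟨max N (m + 1), (Nat.lt_succ_self m).trans_le (le_max_right _ _), fun n => a n *
    ∫ u : ℝ, Complex.exp (-((δ * lam n : ℝ) : ℂ) * (u * Complex.I)) * φ u, ?_, fun t => ?_⟩
  · have h := hone (δ * lam m) (by rwa [abs_of_nonneg (mul_nonneg hδ.le (hlam.nonneg m))])
    simp only [h, mul_one]
  · have hre : ((σ : ℂ) + t * Complex.I).re = σ := by simp
    rw [← vertical_average_eq_partialSum hlam h₀ hf hφc hφ hφ₁ (fun n hn => hzero _ ?_)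
      (by rwa [hre]), norm_sub_rev]
    · exact (norm_vertical_average_sub_le hf.holomorphic hC hφc hφ hφ₁ hφone
        (half_pos hσ) (by rw [hre]; linarith) hδ.le).trans hδK
    · rw [abs_of_nonneg (mul_nonneg hδ.le (hlam.nonneg n)), mul_comm, ← div_le_iff₀ hδ]
      exact hN n ((le_max_left _ _).trans hn)

/-! ### Almost periods and means of Dirichlet polynomials -/

/-- Common almost periods of finitely many characters are relatively dense. -/
lemma exists_common_almost_period (lam : ℕ → ℝ) (N : ℕ) {ε : ℝ} (hε : 0 < ε) :
    ∃ l : ℝ, 0 < l ∧ ∀ x : ℝ, ∃ τ ∈ Set.Icc x (x + l), ∀ n < N,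
      ‖Complex.exp (-(lam n : ℂ) * (τ * Complex.I)) - 1‖ ≤ ε := by
  let e : ℝ → Fin N → ℂ := fun t n => Complex.exp (-(lam n : ℂ) * (t * Complex.I))
  have hnorm : ∀ t n, ‖e t n‖ = 1 := fun t n => by
    simp only [e, Complex.norm_exp]
    simp
  have hbdd : Bornology.IsBounded (Set.range e) := by
    refine (isBounded_iff_forall_norm_le).2 ⟨1, ?_⟩
    rintro _ ⟨t, rfl⟩
    exact (pi_norm_le_iff_of_nonneg zero_le_one).2 fun n => (hnorm t n).le
  -- The curve `e` is bounded in a finite-dimensional space, so finitely many `e t` form an `ε`-net.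
  -- Subtracting from `x + (|L| + 1)` the time of a nearby net point gives `τ` in the required
  -- window.
  obtain ⟨c, hc, hfin, hcov⟩ := Metric.finite_approx_of_totallyBounded
    (hbdd.isCompact_closure.totallyBounded.subset subset_closure) ε hε
  obtain ⟨F, hF⟩ : ∃ F : Set ℝ, F.Finite ∧ e '' F = c :=
    (Set.exists_subset_image_finite_and.1 ⟨c, by rwa [Set.image_univ], hfin, rfl⟩).imp
      fun F h => ⟨h.2.1, h.2.2.symm⟩
  obtain ⟨hFfin, rfl⟩ := hF
  obtain ⟨L, hL⟩ := hFfin.isBounded.exists_norm_le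
  refine ⟨2 * (|L| + 1), by positivity, fun x => ?_⟩
  have hx := hcov ⟨x + (|L| + 1), rfl⟩
  simp only [Set.mem_iUnion, exists_prop, Set.exists_mem_image] at hx
  obtain ⟨t, ht, hxt⟩ := hx
  have htL := abs_le.1 ((hL t ht).trans (le_abs_self L))
  refine ⟨x + (|L| + 1) - t, ⟨by linarith [htL.2], by linarith [htL.1]⟩, fun n hn => ?_⟩
  have h1 : ‖e (x + (|L| + 1)) ⟨n, hn⟩ - e t ⟨n, hn⟩‖ ≤ ε := by
    rw [← dist_eq_norm]
    exact (dist_le_pi_dist _ _ _).trans (Metric.mem_ball.1 hxt).le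
  have h2 : e (x + (|L| + 1)) ⟨n, hn⟩ = Complex.exp
      (-(lam n : ℂ) * ((x + (|L| + 1) - t : ℝ) * Complex.I)) * e t ⟨n, hn⟩ := by
    simp only [e]
    rw [← Complex.exp_add]
    congr 1
    push_cast
    ring
  rwa [h2, ← sub_one_mul, norm_mul, hnorm, mul_one] at h1

/-- Dirichlet polynomials have relatively dense almost periods along vertical lines. -/
lemma exists_almost_period_partialSum (lam : ℕ → ℝ) (b : ℕ → ℂ) (N : ℕ) (σ : ℝ) {ε : ℝ}
    (hε : 0 < ε) : ∃ l : ℝ, 0 < l ∧ ∀ x : ℝ, ∃ τ ∈ Set.Icc x (x + l), ∀ t : ℝ,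
      ‖partialSum lam b N (σ + (t + τ : ℝ) * Complex.I)
        - partialSum lam b N (σ + t * Complex.I)‖ ≤ ε := by
  set K := ∑ n ∈ Finset.range N, ‖b n‖ * Real.exp (-lam n * σ) with hK
  have hK0 : 0 ≤ K := Finset.sum_nonneg fun n _ => by positivity
  obtain ⟨l, hl, h⟩ := exists_common_almost_period lam N (ε := ε / (K + 1)) (by positivity)
  refine ⟨l, hl, fun x => ?_⟩
  obtain ⟨τ, hτ, hτn⟩ := h x
  refine ⟨τ, hτ, fun t => ?_⟩
  unfold partialSum
  rw [← Finset.sum_sub_distrib]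
  calc _ ≤ ∑ n ∈ Finset.range N, ‖b n‖ * Real.exp (-lam n * σ) * (ε / (K + 1)) := by
        refine norm_sum_le_of_le _ fun n hn => ?_
        have h1 : b n * Complex.exp (-(lam n : ℂ) * (σ + (t + τ : ℝ) * Complex.I))
            - b n * Complex.exp (-(lam n : ℂ) * (σ + t * Complex.I)) =
            b n * Complex.exp (-(lam n : ℂ) * (σ + t * Complex.I)) *
              (Complex.exp (-(lam n : ℂ) * (τ * Complex.I)) - 1) := by
          rw [mul_sub, mul_one, mul_assoc, ← Complex.exp_add]
          congr 3
          push_cast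
          ring
        have h2 : ‖Complex.exp (-(lam n : ℂ) * (σ + t * Complex.I))‖ =
            Real.exp (-lam n * σ) := by
          rw [Complex.norm_exp]; simp
        rw [h1, norm_mul, norm_mul, h2]
        exact mul_le_mul_of_nonneg_left (hτn n (Finset.mem_range.1 hn)) (by positivity)
    _ = K * (ε / (K + 1)) := by rw [← Finset.sum_mul]
    _ ≤ ε := by
        rw [mul_div_assoc', div_le_iff₀ (by positivity)]
        nlinarith

/-- The Cesàro mean of a nontrivial character vanishes. -/
lemma tendsto_mean_character (x : ℝ) :
    Tendsto (fun T : ℝ => (1 / (2 * (T : ℂ))) *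
      ∫ t in (-T)..T, Complex.exp ((x : ℂ) * Complex.I * t)) atTop
      (𝓝 (if x = 0 then 1 else 0)) := by
  split_ifs with hx
  · subst hx
    refine tendsto_const_nhds.congr' ?_
    filter_upwards [eventually_gt_atTop 0] with T hT
    have : (T : ℂ) ≠ 0 := by exact_mod_cast hT.ne'
    simp only [Complex.ofReal_zero, zero_mul, Complex.exp_zero, intervalIntegral.integral_const,
      Complex.real_smul]
    push_cast
    field_simp
    norm_num
  · have hxc : (x : ℂ) * Complex.I ≠ 0 :=
      mul_ne_zero (by exact_mod_cast hx) Complex.I_ne_zero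
    have hxp : 0 < |x| := abs_pos.2 hx
    refine squeeze_zero_norm' (a := fun T : ℝ => (1 / |x|) * T⁻¹) ?_
      (by simpa using tendsto_inv_atTop_zero.const_mul (1 / |x|))
    filter_upwards [eventually_gt_atTop 0] with T hT
    rw [integral_exp_mul_complex hxc, norm_mul]
    have hn : ∀ u : ℝ, ‖Complex.exp ((x : ℂ) * Complex.I * u)‖ = 1 := fun u => by
      rw [Complex.norm_exp]; simp
    have h1 : ‖Complex.exp ((x : ℂ) * Complex.I * T)
        - Complex.exp ((x : ℂ) * Complex.I * (-T : ℝ))‖ ≤ 2 :=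
      (norm_sub_le _ _).trans (by rw [hn, hn]; norm_num)
    have h2 : ‖(1 : ℂ) / (2 * (T : ℂ))‖ = 1 / (2 * T) := by
      simp [abs_of_pos hT]
    have h3 : ‖(x : ℂ) * Complex.I‖ = |x| := by simp
    rw [h2, norm_div, h3]
    calc _ ≤ 1 / (2 * T) * (2 / |x|) := by gcongr
      _ = _ := by field_simp

/-- Dirichlet polynomials satisfy the coefficient formula. -/
lemma tendsto_mean_partialSum {lam : ℕ → ℝ} (hlam : IsFrequency lam) (b : ℕ → ℂ) {N m : ℕ}
    (hm : m < N) (σ : ℝ) :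
    Tendsto (fun T : ℝ => (1 / (2 * (T : ℂ))) *
      ∫ t in (-T)..T, partialSum lam b N (σ + t * Complex.I) *
        Complex.exp (((σ : ℂ) + (t : ℂ) * Complex.I) * (lam m : ℂ))) atTop (𝓝 (b m)) := by
  -- The `n`-th summand is a constant times the character of frequency `lam m - lam n`; only `n = m`
  -- has nonzero mean.
  have h := tendsto_finsetSum (Finset.range N) fun n _ =>
    (tendsto_mean_character (lam m - lam n)).const_mul
      (b n * Complex.exp ((lam m - lam n : ℝ) * (σ : ℂ)))
  have hlim : ∑ n ∈ Finset.range N, b n * Complex.exp ((lam m - lam n : ℝ) * (σ : ℂ)) *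
      (if lam m - lam n = 0 then 1 else 0) = b m := by
    rw [Finset.sum_eq_single m]
    · simp
    · intro n _ hn
      rw [if_neg (sub_ne_zero.2 fun h => hn (hlam.strictMono.injective h).symm), mul_zero]
    · intro h; exact absurd (Finset.mem_range.2 hm) h
  rw [hlim] at h
  refine h.congr fun T => ?_
  have hint : ∀ n, IntervalIntegrable (fun t : ℝ =>
      b n * Complex.exp (-(lam n : ℂ) * (σ + t * Complex.I)) *
        Complex.exp (((σ : ℂ) + (t : ℂ) * Complex.I) * (lam m : ℂ))) volume (-T) T := fun n =>
    (by fun_prop : Continuous _).intervalIntegrable _ _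
  simp only [partialSum, Finset.sum_mul]
  rw [intervalIntegral.integral_finsetSum fun n _ => hint n, Finset.mul_sum]
  refine Finset.sum_congr rfl fun n _ => ?_
  rw [mul_left_comm, ← intervalIntegral.integral_const_mul]
  congr 1
  refine intervalIntegral.integral_congr fun t _ => ?_
  simp only [mul_assoc, ← Complex.exp_add]
  congr 2
  push_cast
  ring

/-! ### Passage to the extension -/

lemma IsBddExtension.continuous_vertical {f : ℂ → ℂ} (hf : IsBddExtension lam a f) {σ : ℝ}
    (hσ : 0 < σ) : Continuous fun t : ℝ => f ((σ : ℂ) + (t : ℂ) * Complex.I) := by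
  simpa using continuous_comp_vertical hf.holomorphic (s := (σ : ℂ)) (by simpa using hσ) 1

lemma IsBddExtension.almostPeriodic (hlam : IsFrequency lam) (ha : a ∈ DInftyExt lam) {f : ℂ → ℂ}
    (hf : IsBddExtension lam a f) {σ : ℝ} (hσ : 0 < σ) :
    AlmostPeriodic (fun t : ℝ => f ((σ : ℂ) + (t : ℂ) * Complex.I)) := by
  refine ⟨hf.continuous_vertical hσ, fun ε hε => ?_⟩
  have hε3 : 0 < ε / 3 := by positivity
  obtain ⟨N, -, b, -, hb⟩ := exists_partialSum_near hlam ha hf hσ hε3 0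
  obtain ⟨l, hl, h⟩ := exists_almost_period_partialSum lam b N σ hε3
  refine ⟨l, hl, fun x => ?_⟩
  obtain ⟨τ, hτ, hp⟩ := h x
  refine ⟨τ, hτ, fun t => ?_⟩
  have h1 := hb (t + τ)
  have h2 := hb t
  rw [norm_sub_rev] at h2
  calc _ = ‖(f (σ + (t + τ : ℝ) * Complex.I)
          - partialSum lam b N (σ + (t + τ : ℝ) * Complex.I))
        + (partialSum lam b N (σ + (t + τ : ℝ) * Complex.I)
          - partialSum lam b N (σ + t * Complex.I))
        + (partialSum lam b N (σ + t * Complex.I) - f (σ + t * Complex.I))‖ :=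
        congrArg norm (by ring)
    _ ≤ ε / 3 + ε / 3 + ε / 3 := norm_add_le_of_le (norm_add_le_of_le h1 (hp t)) h2
    _ = ε := by ring

lemma norm_mean_le {g : ℝ → ℂ} {K T : ℝ} (hT : 0 < T) (hg : ∀ t, ‖g t‖ ≤ K) :
    ‖(1 / (2 * (T : ℂ))) * ∫ t in (-T)..T, g t‖ ≤ K := by
  have h1 := intervalIntegral.norm_integral_le_of_norm_le_const (a := -T) (b := T)
    (fun t _ => hg t)
  have h2 : ‖(1 : ℂ) / (2 * (T : ℂ))‖ = 1 / (2 * T) := by simp [abs_of_pos hT]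
  rw [norm_mul, h2]
  have h3 : |T - -T| = 2 * T := by rw [abs_of_pos] <;> linarith
  rw [h3] at h1
  calc _ ≤ 1 / (2 * T) * (K * (2 * T)) := by gcongr
    _ = K := by field_simp

lemma norm_exp_vertical_mul (σ t x : ℝ) :
    ‖Complex.exp (((σ : ℂ) + (t : ℂ) * Complex.I) * (x : ℂ))‖ = Real.exp (σ * x) := by
  rw [Complex.norm_exp]; simp

lemma IsBddExtension.tendsto_mean (hlam : IsFrequency lam) (ha : a ∈ DInftyExt lam) {f : ℂ → ℂ}
    (hf : IsBddExtension lam a f) {σ : ℝ} (hσ : 0 < σ) (m : ℕ) :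
    Tendsto (fun T : ℝ => (1 / (2 * (T : ℂ))) *
      ∫ t in (-T)..T, f ((σ : ℂ) + (t : ℂ) * Complex.I) *
        Complex.exp (((σ : ℂ) + (t : ℂ) * Complex.I) * (lam m : ℂ))) atTop (𝓝 (a m)) := by
  rw [Metric.tendsto_nhds]
  intro ε hε
  -- The factor in the mean has modulus `exp (σ * lam m)`, so the approximation must be finer by
  -- that amount.
  have hη : 0 < ε / 2 / Real.exp (σ * lam m) := by positivity
  obtain ⟨N, hN, b, hbm, hb⟩ := exists_partialSum_near hlam ha hf hσ hη m
  have hmean := Metric.tendsto_nhds.1 (tendsto_mean_partialSum hlam b hN σ) (ε / 2) (half_pos hε)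
  rw [hbm] at hmean
  filter_upwards [hmean, eventually_gt_atTop 0] with T hT hT0
  have hcf := hf.continuous_vertical hσ
  have hcp : Continuous fun t : ℝ => partialSum lam b N (σ + t * Complex.I) :=
    (differentiable_partialSum (lam := lam) (a := b) N).continuous.comp (by fun_prop)
  have hce : Continuous fun t : ℝ =>
      Complex.exp (((σ : ℂ) + (t : ℂ) * Complex.I) * (lam m : ℂ)) := by fun_prop
  have hif : IntervalIntegrable (fun t : ℝ => f ((σ : ℂ) + (t : ℂ) * Complex.I) *
      Complex.exp (((σ : ℂ) + (t : ℂ) * Complex.I) * (lam m : ℂ))) volume (-T) T :=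
    (hcf.mul hce).intervalIntegrable _ _
  have hip : IntervalIntegrable (fun t : ℝ => partialSum lam b N (σ + t * Complex.I) *
      Complex.exp (((σ : ℂ) + (t : ℂ) * Complex.I) * (lam m : ℂ))) volume (-T) T :=
    (hcp.mul hce).intervalIntegrable _ _
  have hdiff : dist ((1 / (2 * (T : ℂ))) * ∫ t in (-T)..T, f ((σ : ℂ) + (t : ℂ) * Complex.I) *
        Complex.exp (((σ : ℂ) + (t : ℂ) * Complex.I) * (lam m : ℂ)))
      ((1 / (2 * (T : ℂ))) * ∫ t in (-T)..T, partialSum lam b N (σ + t * Complex.I) *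
        Complex.exp (((σ : ℂ) + (t : ℂ) * Complex.I) * (lam m : ℂ))) ≤ ε / 2 := by
    rw [dist_eq_norm, ← mul_sub, ← intervalIntegral.integral_sub hif hip]
    refine norm_mean_le hT0 fun t => ?_
    rw [← sub_mul, norm_mul, norm_exp_vertical_mul, ← le_div_iff₀ (Real.exp_pos _)]
    exact hb t
  exact ((dist_triangle _ _ (a m)).trans_lt (add_lt_add_of_le_of_lt hdiff hT)).trans_eq
    (add_halves ε)

/-- For each `σ > 0` the means are bounded by `C * exp (σ * lam m)`. Their limit `a m` does not
depend on `σ`, so `σ` may tend to `0`. -/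
lemma IsBddExtension.norm_coeff_le (hlam : IsFrequency lam) (ha : a ∈ DInftyExt lam) {f : ℂ → ℂ}
    (hf : IsBddExtension lam a f) {C : ℝ} (hC : ∀ s : ℂ, 0 < s.re → ‖f s‖ ≤ C) (m : ℕ) :
    ‖a m‖ ≤ C := by
  have hσ : ∀ σ : ℝ, 0 < σ → ‖a m‖ ≤ C * Real.exp (σ * lam m) := fun σ hσ => by
    refine le_of_tendsto (hf.tendsto_mean hlam ha hσ m).norm ?_
    filter_upwards [eventually_gt_atTop 0] with T hT
    refine norm_mean_le hT fun t => ?_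
    rw [norm_mul, norm_exp_vertical_mul]
    exact mul_le_mul_of_nonneg_right (hC _ (by simpa using hσ)) (Real.exp_pos _).le
  have hlim : Tendsto (fun σ : ℝ => C * Real.exp (σ * lam m)) (𝓝[>] 0) (𝓝 C) := by
    have : Continuous fun σ : ℝ => C * Real.exp (σ * lam m) := by fun_prop
    exact (this.tendsto' 0 C (by simp)).mono_left nhdsWithin_le_nhds
  exact ge_of_tendsto hlim (eventually_mem_nhdsWithin.mono fun σ h => hσ σ h)

/-! ### The norm and the linear structure -/

/-- By uniqueness the extension chosen in `normInfty` agrees with `f` on `[Re > 0]`, so the supremum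
is independent of the choice. -/
lemma IsBddExtension.isLUB_normInfty (hlam : IsFrequency lam) (ha : a ∈ DInftyExt lam)
    {f : ℂ → ℂ} (hf : IsBddExtension lam a f) :
    IsLUB ((fun s : ℂ => ‖f s‖) '' {s : ℂ | 0 < s.re}) (normInfty lam a) := by
  obtain ⟨⟨s₀, h₀⟩, hex⟩ := ha
  have heq : normInfty lam a = ⨆ s : {s : ℂ // 0 < s.re}, ‖f s‖ := by
    rw [normInfty, dif_pos hex]
    exact iSup_congr fun s => by rw [hex.choose_spec.eq_of_convergesAt hlam h₀ hf s.2]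
  rw [heq, Set.image_eq_range]
  have : Nonempty {s : ℂ | 0 < s.re} := ⟨⟨1, by simp⟩⟩
  obtain ⟨C, hC⟩ := hf.bounded
  exact isLUB_ciSup ⟨C, by rintro _ ⟨s, rfl⟩; exact hC s s.2⟩

lemma partialSum_add (b : ℕ → ℂ) (N : ℕ) (s : ℂ) :
    partialSum lam (a + b) N s = partialSum lam a N s + partialSum lam b N s := by
  simp [partialSum, add_mul, Finset.sum_add_distrib]

lemma partialSum_smul (c : ℂ) (N : ℕ) (s : ℂ) :
    partialSum lam (c • a) N s = c * partialSum lam a N s := by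
  simp [partialSum, Finset.mul_sum, mul_assoc]

lemma mem_DInftyExt_add (hlam : IsFrequency lam) {b : ℕ → ℂ} (ha : a ∈ DInftyExt lam)
    (hb : b ∈ DInftyExt lam) {f g : ℂ → ℂ} (hf : IsBddExtension lam a f)
    (hg : IsBddExtension lam b g) :
    a + b ∈ DInftyExt lam ∧ IsBddExtension lam (a + b) (f + g) := by
  obtain ⟨⟨s₀, h₀⟩, -⟩ := ha
  obtain ⟨⟨s₁, h₁⟩, -⟩ := hb
  obtain ⟨C, hC⟩ := hf.bounded
  obtain ⟨D, hD⟩ := hg.bounded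
  set σ := max (max 0 s₀.re) (max 0 s₁.re) with hσ
  have hsum : ∀ s : ℂ, σ < s.re →
      Tendsto (fun N => partialSum lam (a + b) N s) atTop (𝓝 ((f + g) s)) := fun s hs => by
    simp_rw [partialSum_add]
    exact (h₀.tendsto_extension hlam hf ((le_max_left _ _).trans_lt hs)).add
      (h₁.tendsto_extension hlam hg ((le_max_right _ _).trans_lt hs))
  have hext : IsBddExtension lam (a + b) (f + g) :=
    .of_eventually hlam (hf.holomorphic.add hg.holomorphic)
      ⟨C + D, fun s hs => norm_add_le_of_le (hC s hs) (hD s hs)⟩ hsum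
  exact ⟨⟨⟨((σ + 1 : ℝ) : ℂ), _, hsum _ (by rw [Complex.ofReal_re]; linarith)⟩, _, hext⟩, hext⟩

lemma mem_DInftyExt_smul (hlam : IsFrequency lam) (c : ℂ) (ha : a ∈ DInftyExt lam)
    {f : ℂ → ℂ} (hf : IsBddExtension lam a f) :
    c • a ∈ DInftyExt lam ∧ IsBddExtension lam (c • a) (c • f) := by
  obtain ⟨⟨s₀, h₀⟩, -⟩ := ha
  obtain ⟨C, hC⟩ := hf.bounded
  have hsum : ∀ s : ℂ, max 0 s₀.re < s.re →
      Tendsto (fun N => partialSum lam (c • a) N s) atTop (𝓝 ((c • f) s)) := fun s hs => by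
    simp_rw [partialSum_smul]
    exact (h₀.tendsto_extension hlam hf hs).const_mul c
  have hext : IsBddExtension lam (c • a) (c • f) :=
    .of_eventually hlam (hf.holomorphic.const_smul c)
      ⟨‖c‖ * C, fun s hs => by
        rw [Pi.smul_apply, norm_smul]
        exact mul_le_mul_of_nonneg_left (hC s hs) (norm_nonneg c)⟩ hsum
  exact ⟨⟨⟨((max 0 s₀.re + 1 : ℝ) : ℂ), _, hsum _ (by rw [Complex.ofReal_re]; linarith)⟩,
    _, hext⟩, hext⟩

lemma zero_mem_DInftyExt (hlam : IsFrequency lam) : (0 : ℕ → ℂ) ∈ DInftyExt lam := by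
  have h : ∀ s : ℂ, Tendsto (fun N => partialSum lam 0 N s) atTop (𝓝 ((0 : ℂ → ℂ) s)) :=
    fun s => by simp [partialSum]
  exact ⟨⟨0, _, h 0⟩, 0, .of_eventually hlam (differentiableOn_const 0) ⟨0, by simp⟩
    (σ₁ := 0) fun s _ => h s⟩

lemma IsBddExtension.norm_le_normInfty (hlam : IsFrequency lam) (ha : a ∈ DInftyExt lam)
    {f : ℂ → ℂ} (hf : IsBddExtension lam a f) {s : ℂ} (hs : 0 < s.re) :
    ‖f s‖ ≤ normInfty lam a :=
  (hf.isLUB_normInfty hlam ha).1 ⟨s, hs, rfl⟩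

lemma IsBddExtension.normInfty_le (hlam : IsFrequency lam) (ha : a ∈ DInftyExt lam)
    {f : ℂ → ℂ} (hf : IsBddExtension lam a f) {C : ℝ} (hC : ∀ s : ℂ, 0 < s.re → ‖f s‖ ≤ C) :
    normInfty lam a ≤ C :=
  (hf.isLUB_normInfty hlam ha).2 (by rintro _ ⟨s, hs, rfl⟩; exact hC s hs)

lemma norm_coeff_le_normInfty (hlam : IsFrequency lam) (ha : a ∈ DInftyExt lam) (n : ℕ) :
    ‖a n‖ ≤ normInfty lam a := by
  obtain ⟨f, hf⟩ := ha.2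
  exact hf.norm_coeff_le hlam ha (fun s hs => hf.norm_le_normInfty hlam ha hs) n

lemma normInfty_add_le (hlam : IsFrequency lam) {b : ℕ → ℂ} (ha : a ∈ DInftyExt lam)
    (hb : b ∈ DInftyExt lam) :
    normInfty lam (a + b) ≤ normInfty lam a + normInfty lam b := by
  obtain ⟨f, hf⟩ := ha.2
  obtain ⟨g, hg⟩ := hb.2
  obtain ⟨hab, hfg⟩ := mem_DInftyExt_add hlam ha hb hf hg
  exact hfg.normInfty_le hlam hab fun s hs =>
    norm_add_le_of_le (hf.norm_le_normInfty hlam ha hs) (hg.norm_le_normInfty hlam hb hs)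

lemma normInfty_smul_le (hlam : IsFrequency lam) (c : ℂ) (ha : a ∈ DInftyExt lam) :
    normInfty lam (c • a) ≤ ‖c‖ * normInfty lam a := by
  obtain ⟨f, hf⟩ := ha.2
  obtain ⟨hca, hcf⟩ := mem_DInftyExt_smul hlam c ha hf
  refine hcf.normInfty_le hlam hca fun s hs => ?_
  rw [Pi.smul_apply, norm_smul]
  exact mul_le_mul_of_nonneg_left (hf.norm_le_normInfty hlam ha hs) (norm_nonneg c)

/-- `D_∞^ext(lam)` as a subspace of the space of all coefficient sequences. -/
def dInftyExtSubmodule (hlam : IsFrequency lam) : Submodule ℂ (ℕ → ℂ) where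
  carrier := DInftyExt lam
  zero_mem' := zero_mem_DInftyExt hlam
  add_mem' ha hb := (mem_DInftyExt_add hlam ha hb ha.2.choose_spec hb.2.choose_spec).1
  smul_mem' c _ ha := (mem_DInftyExt_smul hlam c ha ha.2.choose_spec).1

lemma normInfty_zero (hlam : IsFrequency lam) : normInfty lam 0 = 0 := by
  have h0 := zero_mem_DInftyExt hlam
  refine le_antisymm ?_ ((norm_nonneg _).trans (norm_coeff_le_normInfty hlam h0 0))
  simpa using normInfty_smul_le hlam 0 h0

/-- `normInfty` as a seminorm on `D_∞^ext(lam)`. -/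
noncomputable def normInftySeminorm (hlam : IsFrequency lam) :
    Seminorm ℂ (dInftyExtSubmodule hlam) :=
  -- One inequality for scalars suffices: the reverse follows by applying it to `c⁻¹` when `c ≠ 0`.
  Seminorm.ofSMulLE (fun a => normInfty lam (a : ℕ → ℂ)) (normInfty_zero hlam)
    (fun a b => normInfty_add_le hlam a.2 b.2) (fun c a => normInfty_smul_le hlam c a.2)

end GenDirichlet

theorem corollary3p9 (lam : ℕ → ℝ) (hlam : GenDirichlet.IsFrequency lam) :
    -- almost periodicity, coefficient formula, and the value of the norm
    (∀ a ∈ GenDirichlet.DInftyExt lam, ∀ f : ℂ → ℂ, GenDirichlet.IsBddExtension lam a f →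
      (∀ σ : ℝ, 0 < σ →
        GenDirichlet.AlmostPeriodic (fun t : ℝ => f ((σ : ℂ) + (t : ℂ) * Complex.I)) ∧
        ∀ n : ℕ, Tendsto
          (fun T : ℝ => (1 / (2 * (T : ℂ))) *
            ∫ t in (-T)..T, f ((σ : ℂ) + (t : ℂ) * Complex.I) *
              Complex.exp (((σ : ℂ) + (t : ℂ) * Complex.I) * (lam n : ℂ)))
          atTop (𝓝 (a n))) ∧
      IsLUB ((fun s : ℂ => ‖f s‖) '' {s : ℂ | 0 < s.re}) (GenDirichlet.normInfty lam a)) ∧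
    -- the coefficients are bounded by the norm
    (∀ a ∈ GenDirichlet.DInftyExt lam, ∀ n : ℕ, ‖a n‖ ≤ GenDirichlet.normInfty lam a) ∧
    -- the space is a linear space, normed by `normInfty`
    (∃ V : Submodule ℂ (ℕ → ℂ), (V : Set (ℕ → ℂ)) = GenDirichlet.DInftyExt lam ∧
      ∃ p : Seminorm ℂ V, (∀ a : V, p a = GenDirichlet.normInfty lam (a : ℕ → ℂ)) ∧
        ∀ a : V, p a = 0 → a = 0) := by
  refine ⟨fun a ha f hf => ⟨fun σ hσ => ⟨hf.almostPeriodic hlam ha hσ,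
    fun n => hf.tendsto_mean hlam ha hσ n⟩, hf.isLUB_normInfty hlam ha⟩,
    fun a ha n => GenDirichlet.norm_coeff_le_normInfty hlam ha n,
    GenDirichlet.dInftyExtSubmodule hlam, rfl, GenDirichlet.normInftySeminorm hlam,
    fun a => rfl, fun a ha => ?_⟩
  -- Definiteness: each coefficient is bounded by the norm, which is `0`.
  ext n
  exact norm_le_zero_iff.1
    ((GenDirichlet.norm_coeff_le_normInfty hlam a.2 n).trans (le_of_eq ha))
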